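/- Let $X$ be a real Banach space with closed unit ball $B_X$ and unit sphere $S_X$. For $x\in S_X$ put $J(x)=\{f\in S_{X^*} : f(x)=1\}$; for $A\subset S_X$ put $J(A)=\bigcup_{a\in A}J(a)$; and let $\mathrm{NA}(S_{X^*})=J(S_X)$ be the set of norm-attaining functionals in $S_{X^*}$. Say that $X$ satisfies condition $(\ast)$ if for every non-empty relatively open $U\subset S_X$ the set $J(U)$ has an interior point relative to $\mathrm{NA}(S_{X^*})$; equivalently, if for every relatively dense $A\subset \mathrm{NA}(S_{X^*})$ the set $\{x\in S_X : J(x)\cap A\neq\emptyset\}$ is dense in $S_X$. A point $x\in S_X$ is a strongly exposed point of $B_X$ if there is $f\in S_{X^*}$ such that every sequence $(x_n)\subset B_X$ with $f(x_n)\to 1$ converges to $x$ in norm. A Banach space is called Asplund if each of its separable closed subspaces has a separable dual. Suppose that $X^*$ is an Asplund space. Then $X$ satisfies condition $(\ast)$ if and only if the set of strongly exposed points of $B_X$ is dense in $S_X$. -/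

import Mathlib

open Filter Topology

namespace BanachGeometry

/-- The duality mapping `J(x) = {f ∈ S_{X*} | f(x) = 1}` (used for `x` in the unit sphere). -/
def dualityMap {X : Type*} [NormedAddCommGroup X] [NormedSpace ℝ X] (x : X) :
    Set (StrongDual ℝ X) :=
  {f | f ∈ Metric.sphere (0 : StrongDual ℝ X) 1 ∧ f x = 1}

/-- The image `J(A) = ⋃_{a ∈ A} J(a)` of a set `A ⊆ S_X`. -/
def dualityImage {X : Type*} [NormedAddCommGroup X] [NormedSpace ℝ X] (A : Set X) :
    Set (StrongDual ℝ X) :=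
  ⋃ a ∈ A, dualityMap a

/-- The norm-attaining functionals of norm one, `NA(S_{X*}) = J(S_X)`. -/
def normAttaining (X : Type*) [NormedAddCommGroup X] [NormedSpace ℝ X] :
    Set (StrongDual ℝ X) :=
  dualityImage (Metric.sphere (0 : X) 1)

/-- `X` is an Asplund space: every separable closed subspace `Y` of `X` has a (norm-)separable
dual. -/
def IsAsplund (X : Type*) [NormedAddCommGroup X] [NormedSpace ℝ X] : Prop :=
  ∀ Y : Submodule ℝ X, IsClosed (Y : Set X) → TopologicalSpace.SeparableSpace Y →
    TopologicalSpace.SeparableSpace (StrongDual ℝ Y)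

/-- `f` strongly exposes `x`: every sequence `(uₙ)` in the closed unit ball with `f(uₙ) → 1`
converges to `x` in norm. -/
def StronglyExposes {X : Type*} [NormedAddCommGroup X] [NormedSpace ℝ X]
    (f : StrongDual ℝ X) (x : X) : Prop :=
  ∀ u : ℕ → X, (∀ n, u n ∈ Metric.closedBall (0 : X) 1) →
    Tendsto (fun n => f (u n)) atTop (𝓝 1) → Tendsto u atTop (𝓝 x)

/-- The set of strongly exposed points of the closed unit ball of `X`. -/
def stronglyExposedPoints (X : Type*) [NormedAddCommGroup X] [NormedSpace ℝ X] : Set X :=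
  {x | x ∈ Metric.sphere (0 : X) 1 ∧
    ∃ f ∈ Metric.sphere (0 : StrongDual ℝ X) 1, StronglyExposes f x}

/-- Condition (∗): for each relatively open non-empty `U ∩ S_X` in `S_X`, the set `J(U ∩ S_X)` has
an interior point relative to `NA(S_{X*})`, i.e. it contains `V ∩ NA(S_{X*})` for some open `V`
meeting `NA(S_{X*})`. -/
def ConditionStar (X : Type*) [NormedAddCommGroup X] [NormedSpace ℝ X] : Prop :=
  ∀ U : Set X, IsOpen U → (U ∩ Metric.sphere (0 : X) 1).Nonempty →
    ∃ V : Set (StrongDual ℝ X), IsOpen V ∧ (V ∩ normAttaining X).Nonempty ∧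
      V ∩ normAttaining X ⊆ dualityImage (U ∩ Metric.sphere (0 : X) 1)

/-- The second, equivalent, form of condition (∗): for each relatively dense `A ⊆ NA(S_{X*})` the
set `{x ∈ S_X | J(x) ∩ A ≠ ∅}` is dense in `S_X`. -/
def ConditionStarDense (X : Type*) [NormedAddCommGroup X] [NormedSpace ℝ X] : Prop :=
  ∀ A : Set (StrongDual ℝ X), A ⊆ normAttaining X → normAttaining X ⊆ closure A →
    Metric.sphere (0 : X) 1 ⊆
      closure {x | x ∈ Metric.sphere (0 : X) 1 ∧ (dualityMap x ∩ A).Nonempty}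

/-- The two forms of condition (∗) agree. -/
theorem conditionStar_iff_dense (X : Type*) [NormedAddCommGroup X] [NormedSpace ℝ X] :
    ConditionStar X ↔ ConditionStarDense X := by
  constructor
  · intro h A hAN hA x hx
    rw [mem_closure_iff]
    intro U hU hxU
    obtain ⟨V, hV, ⟨f, hfV, hf⟩, hsub⟩ := h U hU ⟨x, hxU, hx⟩
    obtain ⟨g, hgV, hgA⟩ := mem_closure_iff.1 (hA hf) V hV hfV
    have hg := hsub ⟨hgV, hAN hgA⟩
    simp only [dualityImage, Set.mem_iUnion] at hg
    obtain ⟨y, ⟨hyU, hyS⟩, hgy⟩ := hg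
    exact ⟨y, hyU, hyS, g, hgy, hgA⟩
  · intro h U hU ⟨x, hxU, hxS⟩
    by_contra hcon
    have hd : normAttaining X ⊆
        closure (normAttaining X \ dualityImage (U ∩ Metric.sphere (0 : X) 1)) := by
      intro f hf
      rw [mem_closure_iff]
      intro V hV hfV
      by_contra hne
      refine hcon ⟨V, hV, ⟨f, hfV, hf⟩, fun g hg => ?_⟩
      by_contra hgn
      exact hne ⟨g, hg.1, hg.2, hgn⟩
    obtain ⟨y, hyU, hyS, g, hgy, hgA⟩ :=
      mem_closure_iff.1 (h _ Set.sdiff_subset hd hxS) U hU hxU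
    exact hgA.2 (Set.mem_biUnion (show y ∈ U ∩ Metric.sphere (0 : X) 1 from ⟨hyU, hyS⟩) hgy)

end BanachGeometry

/-!
If `f` strongly exposes `x ∈ U`, then some slice `{u ∈ B_X | f u > 1 - δ}` lies in `U`, so every
norm-attaining `g` within `δ` of `f` attains its norm only inside `U`. This gives `(∗)` whenever the
strongly exposed points are dense.

Conversely, `(∗)` in its dense form transports density in the set of norm-attaining functionals to
density in `S_X`, so it is enough to show that the strongly exposing functionals are dense in
`S_{X*}` (`exists_stronglyExposes_dist_lt`). By Baire's theorem in `X*` this reduces to the density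
of the open sets `smallSlices X ε` of functionals having a slice of `B_X` of diameter at most `ε`.

That density (`dense_smallSlices`) is where the Asplund hypothesis enters. If it fails on a ball
`V` of `X*`, then for `f ∈ V` every slice contains two points that are at least `ε` apart, as
witnessed by some `g` in the unit ball of `X*`. Closing up under countably many such choices
yields a closed separable subspace `Y` of `X*` containing all the witnesses for a dense set of
`f ∈ Y`. The dual of `Y` is separable, so `Y` is covered by countably many sets `nearSubgradient c r`,
with `c` in a dense sequence of `Y*`, consisting of points at which the norm has a subgradient
within `r` of `c`, up to an inequality which makes these sets closed. One of them has interior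
meeting `V`, and near an interior point the norm of `Y` varies like `c` up to `r`; this forces thin
slices to have small diameter as seen by `Y`, a contradiction.
-/

namespace BanachGeometry

/-! ### Countable closure and separable subspaces -/

/-- Separable reduction: starting from a point, one can close up under countably many unary
operations inside a closed separable subspace, with the operations acting on a dense subset. -/
theorem exists_separable_submodule_closed_under {E : Type*} [NormedAddCommGroup E]
    [NormedSpace ℝ E] (Φ : ℕ → E → E) (e : E) :
    ∃ (Y : Submodule ℝ E) (D : Set E), IsClosed (Y : Set E) ∧
      TopologicalSpace.SeparableSpace Y ∧ closure D = Y ∧ e ∈ D ∧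
      ∀ n, ∀ f ∈ D, Φ n f ∈ D := by
  let step : Set E → Set E := fun S =>
    S ∪ Set.image2 (· + ·) S S ∪ (⋃ q : ℚ, (fun f => (q : ℝ) • f) '' S) ∪ ⋃ n, Φ n '' S
  let S : ℕ → Set E := fun m => step^[m] {e}
  have hsucc : ∀ m, S (m + 1) = step (S m) := fun m => Function.iterate_succ_apply' _ _ _
  have hcount : ∀ m, (S m).Countable := by
    intro m
    induction m with
    | zero => exact Set.countable_singleton e
    | succ m ih =>
      rw [hsucc]
      exact ((ih.union (ih.image2 ih _)).union
        (Set.countable_iUnion fun q => ih.image _)).union (Set.countable_iUnion fun n => ih.image _)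
  have hmono : Monotone S := monotone_nat_of_le_succ fun m => by
    rw [hsucc]
    exact fun x hx => Or.inl (Or.inl (Or.inl hx))
  let D : Set E := ⋃ m, S m
  have hDadd : ∀ f ∈ D, ∀ g ∈ D, f + g ∈ D := by
    intro f hf g hg
    obtain ⟨i, hi⟩ := Set.mem_iUnion.1 hf
    obtain ⟨j, hj⟩ := Set.mem_iUnion.1 hg
    refine Set.mem_iUnion.2 ⟨max i j + 1, ?_⟩
    rw [hsucc]
    exact Or.inl (Or.inl (Or.inr ⟨f, hmono (le_max_left i j) hi, g,
      hmono (le_max_right i j) hj, rfl⟩))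
  have hDsmul : ∀ q : ℚ, ∀ f ∈ D, (q : ℝ) • f ∈ D := by
    intro q f hf
    obtain ⟨i, hi⟩ := Set.mem_iUnion.1 hf
    refine Set.mem_iUnion.2 ⟨i + 1, ?_⟩
    rw [hsucc]
    exact Or.inl (Or.inr (Set.mem_iUnion.2 ⟨q, f, hi, rfl⟩))
  have hDΦ : ∀ n, ∀ f ∈ D, Φ n f ∈ D := by
    intro n f hf
    obtain ⟨i, hi⟩ := Set.mem_iUnion.1 hf
    refine Set.mem_iUnion.2 ⟨i + 1, ?_⟩
    rw [hsucc]
    exact Or.inr (Set.mem_iUnion.2 ⟨n, f, hi, rfl⟩)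
  have heD : e ∈ D := Set.mem_iUnion.2 ⟨0, rfl⟩
  have hsep : TopologicalSpace.IsSeparable (closure D) :=
    (Set.countable_iUnion hcount).isSeparable.closure
  -- Closedness under rational scalars passes to real scalars in the closure.
  let Y : Submodule ℝ E :=
    { carrier := closure D
      add_mem' := fun hf hg => map_mem_closure₂ continuous_add hf hg hDadd
      zero_mem' := subset_closure (by simpa using hDsmul 0 e heD)
      smul_mem' := fun r f hf => map_mem_closure₂ continuous_smul
        (Rat.denseRange_cast (𝕜 := ℝ) r) hf (by
          rintro _ ⟨q, rfl⟩ g hg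
          exact hDsmul q g hg) }
  exact ⟨Y, D, isClosed_closure, hsep.separableSpace, rfl, heD, hDΦ⟩

/-! ### Approximate subgradients of the norm -/

/-- The points `f` at which `c` is a subgradient of the norm up to an error `r`, i.e.
`‖f‖ + c y - r ‖y‖ ≤ ‖f + y‖` for all `y`. It contains every `f` at which the norm has a genuine
subgradient at distance at most `r` from `c`. -/
def nearSubgradient {Y : Type*} [NormedAddCommGroup Y] [NormedSpace ℝ Y]
    (c : StrongDual ℝ Y) (r : ℝ) : Set Y :=
  {f | ∀ y, ‖f‖ + c y - r * ‖y‖ ≤ ‖f + y‖}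

section nearSubgradient

variable {Y : Type*} [NormedAddCommGroup Y] [NormedSpace ℝ Y]

theorem isClosed_nearSubgradient (c : StrongDual ℝ Y) (r : ℝ) :
    IsClosed (nearSubgradient c r) := by
  simp only [nearSubgradient, Set.ofPred_forall]
  exact isClosed_iInter fun y => isClosed_le (by fun_prop) (by fun_prop)

theorem iUnion_nearSubgradient_of_denseRange {ι : Type*} {c : ι → StrongDual ℝ Y}
    (hc : DenseRange c) {r : ℝ} (hr : 0 < r) : ⋃ i, nearSubgradient (c i) r = Set.univ := by
  refine Set.eq_univ_of_forall fun f => ?_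
  obtain ⟨h, h1, hf⟩ := exists_dual_vector'' ℝ f
  obtain ⟨i, hi⟩ := hc.exists_dist_lt h hr
  refine Set.mem_iUnion.2 ⟨i, fun y => ?_⟩
  have h2 : h (f + y) ≤ ‖f + y‖ :=
    (le_abs_self _).trans (by simpa using h.le_of_opNorm_le h1 (f + y))
  have h3 : (c i - h) y ≤ r * ‖y‖ := (le_abs_self _).trans
    ((c i - h).le_of_opNorm_le (by rw [← dist_eq_norm, dist_comm]; exact hi.le) y)
  rw [map_add, hf] at h2
  simp only [sub_apply] at h3
  simp only [RCLike.ofReal_real_eq_id, id_eq] at h2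
  linarith

/-- At a point `f + z` of `nearSubgradient c r`, a functional `φ` that is dominated by the norm and
almost norms `f` cannot exceed `c` on `z` by much. -/
theorem apply_le_of_add_mem_nearSubgradient {c φ : StrongDual ℝ Y} {r δ : ℝ} {f z : Y}
    (hz : f + z ∈ nearSubgradient c r) (hφ : ∀ y, φ y ≤ ‖y‖) (hf : ‖f‖ - δ < φ f) :
    φ z ≤ c z + r * ‖z‖ + δ := by
  have h1 := hz (-z)
  have h2 := hφ (f + z)
  simp only [add_neg_cancel_right, map_neg, norm_neg] at h1
  rw [map_add] at h2
  linarith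

end nearSubgradient

/-! ### Functionals with small slices -/

/-- The functionals `f` for which some slice `{x ∈ B_X | f x > ‖f‖ - δ}` has diameter at
most `ε`. -/
def smallSlices (X : Type*) [NormedAddCommGroup X] [NormedSpace ℝ X] (ε : ℝ) :
    Set (StrongDual ℝ X) :=
  {f | ∃ δ > 0, ∀ x y : X, ‖x‖ ≤ 1 → ‖y‖ ≤ 1 → ‖f‖ - δ < f x → ‖f‖ - δ < f y → ‖x - y‖ ≤ ε}

section smallSlices

variable {X : Type*} [NormedAddCommGroup X] [NormedSpace ℝ X]

theorem abs_sub_apply_le_dist (f g : StrongDual ℝ X) {x : X} (hx : ‖x‖ ≤ 1) :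
    |f x - g x| ≤ dist f g := by
  rw [dist_eq_norm]
  exact (f - g).le_of_opNorm_le_of_le le_rfl hx |>.trans (mul_one _).le

theorem isOpen_smallSlices (ε : ℝ) : IsOpen (smallSlices X ε) := by
  rw [Metric.isOpen_iff]
  rintro f ⟨δ, hδ, h⟩
  refine ⟨δ / 3, by positivity, fun g hg => ⟨δ / 3, by positivity, ?_⟩⟩
  have hgf : dist g f < δ / 3 := hg
  have hn : ‖f‖ - ‖g‖ ≤ dist g f := by
    rw [dist_comm, dist_eq_norm]
    exact norm_sub_norm_le f g
  intro x y hx hy hgx hgy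
  have h1 := (abs_le.1 (abs_sub_apply_le_dist g f hx)).2
  have h2 := (abs_le.1 (abs_sub_apply_le_dist g f hy)).2
  exact h x y hx hy (by linarith) (by linarith)

/-- The dual norm of an Asplund dual is almost Fréchet differentiable, in quantitative form, at a
dense set of points. -/
theorem dense_smallSlices (hX : IsAsplund (StrongDual ℝ X)) {ε : ℝ} (hε : 0 < ε) :
    Dense (smallSlices X ε) := by
  by_contra hnd
  obtain ⟨f₀, hf₀⟩ : ∃ f₀, f₀ ∉ closure (smallSlices X ε) := by
    simpa [Dense] using hnd
  let V : Set (StrongDual ℝ X) := (closure (smallSlices X ε))ᶜ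
  have hV : IsOpen V := isClosed_closure.isOpen_compl
  have key : ∀ (n : ℕ) (f : StrongDual ℝ X), ∃ g : StrongDual ℝ X, f ∈ V →
      ‖g‖ ≤ 1 ∧ ∃ x y : X, ‖x‖ ≤ 1 ∧ ‖y‖ ≤ 1 ∧ ‖f‖ - 1 / ((n : ℝ) + 1) < f x ∧
        ‖f‖ - 1 / ((n : ℝ) + 1) < f y ∧ ε < g x - g y := by
    intro n f
    by_cases hf : f ∈ V
    · have hfs : f ∉ smallSlices X ε := fun h => hf (subset_closure h)
      simp only [smallSlices, Set.mem_ofPred_eq, not_exists, not_and] at hfs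
      have := hfs (1 / ((n : ℝ) + 1)) (by positivity)
      push Not at this
      obtain ⟨x, y, hx, hy, hfx, hfy, hxy⟩ := this
      obtain ⟨g, hg, hgxy⟩ := exists_dual_vector'' ℝ (x - y)
      refine ⟨g, fun _ => ⟨hg, x, y, hx, hy, hfx, hfy, ?_⟩⟩
      rw [← map_sub, hgxy]
      simpa using hxy
    · exact ⟨0, fun h => absurd h hf⟩
  choose Φ hΦ using key
  obtain ⟨Y, D, hYc, hYs, hDY, hf₀D, hDΦ⟩ := exists_separable_submodule_closed_under Φ f₀
  have hDsub : D ⊆ Y := hDY ▸ subset_closure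
  have : CompleteSpace Y := hYc.completeSpace_coe
  have : BaireSpace Y := BaireSpace.of_completelyPseudoMetrizable
  have : TopologicalSpace.SeparableSpace (StrongDual ℝ Y) := hX Y hYc hYs
  have hr : 0 < ε / 4 := by positivity
  have hdense := dense_iUnion_interior_of_closed
    (fun k => isClosed_nearSubgradient (TopologicalSpace.denseSeq (StrongDual ℝ Y) k) (ε / 4))
    (iUnion_nearSubgradient_of_denseRange
      (TopologicalSpace.denseRange_denseSeq (StrongDual ℝ Y)) hr)
  obtain ⟨f₁, hf₁V, hf₁⟩ := hdense.inter_open_nonempty (((↑) : Y → StrongDual ℝ X) ⁻¹' V)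
    (hV.preimage continuous_subtype_val) ⟨⟨f₀, hDsub hf₀D⟩, hf₀⟩
  obtain ⟨k, hk⟩ := Set.mem_iUnion.1 hf₁
  generalize TopologicalSpace.denseSeq (StrongDual ℝ Y) k = c at hk
  have hDdense : Dense (((↑) : Y → StrongDual ℝ X) ⁻¹' D) := by
    refine Subtype.dense_iff.2 (hDY.ge.trans (closure_mono fun f hf => ?_))
    exact ⟨⟨f, hDsub hf⟩, hf, rfl⟩
  obtain ⟨f, ⟨hfV, hfint⟩, hfD⟩ := hDdense.inter_open_nonempty _
    ((hV.preimage continuous_subtype_val).inter isOpen_interior) ⟨f₁, hf₁V, hk⟩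
  obtain ⟨s, hs, hball⟩ := Metric.isOpen_iff.1 isOpen_interior f hfint
  have ht : 0 < s / 2 := by positivity
  obtain ⟨n, hn⟩ := exists_nat_one_div_lt (show 0 < s / 2 * (ε / 4) by positivity)
  obtain ⟨hg1, x, y, hx, hy, hfx, hfy, hgxy⟩ := hΦ n f hfV
  let g : Y := ⟨Φ n f, hDsub (hDΦ n f hfD)⟩
  have hg : ‖g‖ ≤ 1 := hg1
  -- Points of the unit ball of `X` act on `Y` as functionals of norm at most one.
  let ev : X → StrongDual ℝ Y := fun u =>
    (ContinuousLinearMap.apply ℝ ℝ u).comp Y.subtypeL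
  have hev : ∀ u : X, ‖u‖ ≤ 1 → ∀ z : Y, ev u z ≤ ‖z‖ := fun u hu z =>
    (le_abs_self _).trans <| ((z : StrongDual ℝ X).le_of_opNorm_le_of_le le_rfl hu).trans
      (mul_one _).le
  have hmem : ∀ z : Y, ‖z‖ ≤ s / 2 → f + z ∈ nearSubgradient c (ε / 4) := fun z hz =>
    interior_subset (hball (by simpa using hz.trans_lt (half_lt_self hs)))
  have htg : ‖(s / 2) • g‖ ≤ s / 2 := by
    rw [norm_smul, Real.norm_of_nonneg ht.le]
    exact mul_le_of_le_one_right ht.le hg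
  -- Moving from `f` by `(s / 2) • g` bounds `g x` above, moving by its opposite bounds `g y` below;
  -- the contributions of `c` cancel in the difference.
  have h1 := apply_le_of_add_mem_nearSubgradient (hmem _ htg) (hev x hx) hfx
  have h2 := apply_le_of_add_mem_nearSubgradient (hmem (-((s / 2) • g)) (by rwa [norm_neg]))
    (hev y hy) hfy
  have e1 : ev x ((s / 2) • g) = s / 2 * Φ n f x := rfl
  have e2 : ev y ((s / 2) • g) = s / 2 * Φ n f y := rfl
  rw [map_neg, map_neg, norm_neg, e2] at h2
  rw [e1] at h1
  have h3 : ε / 4 * ‖(s / 2) • g‖ ≤ ε / 4 * (s / 2) := by gcongr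
  have h4 : s / 2 * ε < s / 2 * (Φ n f x - Φ n f y) := by gcongr
  linarith

end smallSlices

/-! ### Strongly exposing functionals -/

section StronglyExposes

variable {X : Type*} [NormedAddCommGroup X] [NormedSpace ℝ X]

theorem exists_seq_tendsto_norm (f : StrongDual ℝ X) :
    ∃ u : ℕ → X, (∀ n, ‖u n‖ ≤ 1) ∧ Tendsto (fun n => f (u n)) atTop (𝓝 ‖f‖) := by
  have h : ∀ n : ℕ, ∃ x : X, ‖x‖ ≤ 1 ∧ ‖f‖ - 1 / ((n : ℝ) + 1) < f x := by
    intro n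
    by_contra! hcon
    have hpos : (0 : ℝ) < 1 / ((n : ℝ) + 1) := by positivity
    have h0 : (0 : ℝ) ≤ ‖f‖ - 1 / ((n : ℝ) + 1) := by simpa using hcon 0 (by simp)
    have := f.opNorm_le_of_unit_norm h0 fun x hx => by
      have h1 := hcon x hx.le
      have h2 := hcon (-x) (by rw [norm_neg]; exact hx.le)
      rw [map_neg] at h2
      exact abs_le.2 ⟨by linarith, h1⟩
    linarith
  choose u hu hfu using h
  refine ⟨u, hu, tendsto_of_tendsto_of_tendsto_of_le_of_le (g := fun n : ℕ =>
    ‖f‖ - 1 / ((n : ℝ) + 1)) ?_ tendsto_const_nhds (fun n => (hfu n).le) fun n => ?_⟩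
  · simpa using (tendsto_const_nhds (x := ‖f‖)).sub (tendsto_one_div_add_atTop_nhds_zero_nat (𝕜 := ℝ))
  · exact (le_abs_self _).trans
      ((f.le_of_opNorm_le_of_le le_rfl (hu n)).trans (mul_one _).le)

/-- A strongly exposing norm-one functional attains its norm at the point it exposes. -/
theorem StronglyExposes.norm_eq_one_and_apply_eq_one {f : StrongDual ℝ X} {x : X}
    (h : StronglyExposes f x) (hf : ‖f‖ = 1) : ‖x‖ = 1 ∧ f x = 1 := by
  obtain ⟨u, hu, hfu⟩ := exists_seq_tendsto_norm f
  rw [hf] at hfu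
  have hux : Tendsto u atTop (𝓝 x) := h u (fun n => by simpa using hu n) hfu
  have hfx : f x = 1 := tendsto_nhds_unique ((f.continuous.tendsto x).comp hux) hfu
  refine ⟨le_antisymm (le_of_tendsto hux.norm (Eventually.of_forall hu)) ?_, hfx⟩
  simpa [hfx, hf] using f.le_opNorm x

theorem StronglyExposes.eq_of_apply_eq_one {f : StrongDual ℝ X} {x y : X}
    (h : StronglyExposes f x) (hy : ‖y‖ ≤ 1) (hfy : f y = 1) : y = x :=
  tendsto_nhds_unique tendsto_const_nhds
    (h (fun _ => y) (fun _ => by simpa using hy) (by simp [hfy]))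

/-- The slices of a strongly exposing functional form a neighbourhood basis of the exposed point
in the unit ball. -/
theorem StronglyExposes.exists_slice_subset {f : StrongDual ℝ X} {x : X}
    (h : StronglyExposes f x) (hf : ‖f‖ ≤ 1) {U : Set X} (hU : IsOpen U) (hxU : x ∈ U) :
    ∃ δ > 0, ∀ y : X, ‖y‖ ≤ 1 → 1 - δ < f y → y ∈ U := by
  by_contra! hcon
  choose u hu hfu huU using fun n : ℕ => hcon (1 / ((n : ℝ) + 1)) (by positivity)
  have hlim : Tendsto (fun n => f (u n)) atTop (𝓝 1) := by
    refine tendsto_of_tendsto_of_tendsto_of_le_of_le (g := fun n : ℕ => 1 - 1 / ((n : ℝ) + 1)) ?_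
      tendsto_const_nhds (fun n => (hfu n).le) fun n => ?_
    · simpa using
        (tendsto_const_nhds (x := (1 : ℝ))).sub (tendsto_one_div_add_atTop_nhds_zero_nat (𝕜 := ℝ))
    · exact (le_abs_self _).trans ((f.le_of_opNorm_le_of_le hf (hu n)).trans (mul_one _).le)
  obtain ⟨n, hn⟩ := ((h u (fun n => by simpa using hu n) hlim).eventually (hU.mem_nhds hxU)).exists
  exact huU n hn

/-- A nonzero functional with slices of arbitrarily small diameter strongly exposes a point, after
normalization. -/
theorem exists_stronglyExposes_of_forall_mem_smallSlices [CompleteSpace X] {f : StrongDual ℝ X}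
    (hf : f ≠ 0) (h : ∀ n : ℕ, f ∈ smallSlices X (1 / ((n : ℝ) + 1))) :
    ∃ x, StronglyExposes (‖f‖⁻¹ • f) x := by
  have hf0 : ‖f‖ ≠ 0 := norm_ne_zero_iff.2 hf
  -- Any two norming sequences are eventually arbitrarily close to each other.
  have hclose : ∀ u v : ℕ → X, (∀ n, ‖u n‖ ≤ 1) → (∀ n, ‖v n‖ ≤ 1) →
      Tendsto (fun n => f (u n)) atTop (𝓝 ‖f‖) → Tendsto (fun n => f (v n)) atTop (𝓝 ‖f‖) →
      ∀ ε > 0, ∃ N, ∀ m ≥ N, ∀ n ≥ N, dist (u m) (v n) < ε := by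
    intro u v hu hv hfu hfv ε hε
    obtain ⟨k, hk⟩ := exists_nat_one_div_lt hε
    obtain ⟨δ, hδ, hd⟩ := h k
    obtain ⟨N, hN⟩ := eventually_atTop.1
      ((hfu.eventually_const_lt (sub_lt_self ‖f‖ hδ)).and
        (hfv.eventually_const_lt (sub_lt_self ‖f‖ hδ)))
    refine ⟨N, fun m hm n hn => ?_⟩
    rw [dist_eq_norm]
    exact (hd _ _ (hu m) (hv n) (hN m hm).1 (hN n hn).2).trans_lt hk
  obtain ⟨u, hu, hfu⟩ := exists_seq_tendsto_norm f
  obtain ⟨x, hx⟩ := cauchySeq_tendsto_of_complete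
    (Metric.cauchySeq_iff.2 (hclose u u hu hu hfu hfu))
  refine ⟨x, fun v hv hfv => ?_⟩
  have hv' : ∀ n, ‖v n‖ ≤ 1 := fun n => by simpa using hv n
  have hfv' : Tendsto (fun n => f (v n)) atTop (𝓝 ‖f‖) := by
    have := hfv.const_mul ‖f‖
    simpa [mul_inv_cancel_left₀ hf0] using this
  refine tendsto_of_tendsto_of_dist hx (Metric.tendsto_atTop.2 fun ε hε => ?_)
  obtain ⟨N, hN⟩ := hclose u v hu hv' hfu hfv' ε hε
  exact ⟨N, fun n hn => by simpa [abs_of_nonneg dist_nonneg] using hN n hn n hn⟩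

theorem exists_stronglyExposes_dist_lt [CompleteSpace X] (hX : IsAsplund (StrongDual ℝ X))
    {f : StrongDual ℝ X} (hf : ‖f‖ = 1) {ε : ℝ} (hε : 0 < ε) :
    ∃ g : StrongDual ℝ X, ‖g‖ = 1 ∧ dist f g < ε ∧ ∃ x, StronglyExposes g x := by
  have hdense : Dense (⋂ n : ℕ, smallSlices X (1 / ((n : ℝ) + 1))) :=
    dense_iInter_of_isOpen_nat (fun n => isOpen_smallSlices _)
      fun n => dense_smallSlices hX (by positivity)
  have hf0 : f ≠ 0 := by
    rintro rfl
    simp at hf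
  -- Normalization is continuous away from zero and fixes `f`.
  have hcont : ContinuousAt (fun g : StrongDual ℝ X => ‖g‖⁻¹ • g) f :=
    (continuous_norm.continuousAt.inv₀ (norm_ne_zero_iff.2 hf0)).smul continuousAt_id
  have hnear : ∀ᶠ g in 𝓝 f, g ≠ 0 ∧ dist (‖g‖⁻¹ • g) f < ε := by
    refine (eventually_ne_nhds hf0).and ?_
    have := hcont.tendsto
    simp only [hf, inv_one, one_smul] at this
    exact (Metric.tendsto_nhds.1 this) ε hε
  obtain ⟨h, hh, hhs⟩ := (mem_closure_iff_frequently.1 (hdense f)).and_eventually hnear |>.exists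
  refine ⟨‖h‖⁻¹ • h, ?_, by rw [dist_comm]; exact hhs.2,
    exists_stronglyExposes_of_forall_mem_smallSlices hhs.1 (Set.mem_iInter.1 hh)⟩
  rw [norm_smul, norm_inv, norm_norm, inv_mul_cancel₀ (norm_ne_zero_iff.2 hhs.1)]

end StronglyExposes

/-! ### Condition `(∗)` and strongly exposed points -/

section ConditionStar

variable {X : Type*} [NormedAddCommGroup X] [NormedSpace ℝ X]

theorem mem_dualityImage_iff {A : Set X} {f : StrongDual ℝ X} :
    f ∈ dualityImage A ↔ ∃ x ∈ A, ‖f‖ = 1 ∧ f x = 1 := by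
  simp only [dualityImage, dualityMap, Set.mem_iUnion, Set.mem_ofPred_eq, mem_sphere_zero_iff_norm,
    exists_prop]

theorem conditionStar_of_dense_stronglyExposedPoints
    (h : Metric.sphere (0 : X) 1 ⊆ closure (stronglyExposedPoints X)) : ConditionStar X := by
  rintro U hU ⟨x₀, hx₀U, hx₀⟩
  obtain ⟨x, hxU, hx, f, hf, hfx⟩ := mem_closure_iff.1 (h hx₀) U hU hx₀U
  have hf1 : ‖f‖ = 1 := by simpa using hf
  obtain ⟨δ, hδ, hslice⟩ := hfx.exists_slice_subset hf1.le hU hxU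
  refine ⟨Metric.ball f δ, Metric.isOpen_ball, ⟨f, Metric.mem_ball_self hδ,
    mem_dualityImage_iff.2 ⟨x, hx, hf1, (hfx.norm_eq_one_and_apply_eq_one hf1).2⟩⟩, ?_⟩
  rintro g ⟨hgf, hg⟩
  obtain ⟨y, hy, hg1, hgy⟩ := mem_dualityImage_iff.1 hg
  have hy1 : ‖y‖ ≤ 1 := (show ‖y‖ = 1 by simpa using hy).le
  have hle := (abs_le.1 (abs_sub_apply_le_dist g f hy1)).2
  have hlt : dist g f < δ := hgf
  exact mem_dualityImage_iff.2 ⟨y, ⟨hslice y hy1 (by linarith), hy⟩, hg1, hgy⟩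

theorem ConditionStar.dense_stronglyExposedPoints [CompleteSpace X]
    (hX : IsAsplund (StrongDual ℝ X)) (h : ConditionStar X) :
    Metric.sphere (0 : X) 1 ⊆ closure (stronglyExposedPoints X) := by
  refine ((conditionStar_iff_dense X).1 h
    {f | ‖f‖ = 1 ∧ ∃ x, StronglyExposes f x} ?_ ?_).trans (closure_mono ?_)
  · rintro f ⟨hf, x, hfx⟩
    obtain ⟨hx, hfx1⟩ := hfx.norm_eq_one_and_apply_eq_one hf
    exact mem_dualityImage_iff.2 ⟨x, by simpa using hx, hf, hfx1⟩
  · intro f hf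
    obtain ⟨-, -, hf1, -⟩ := mem_dualityImage_iff.1 hf
    refine Metric.mem_closure_iff.2 fun ε hε => ?_
    obtain ⟨g, hg, hfg, hgx⟩ := exists_stronglyExposes_dist_lt hX hf1 hε
    exact ⟨g, ⟨hg, hgx⟩, hfg⟩
  · rintro x ⟨hx, f, ⟨hf, hfx⟩, -, y, hfy⟩
    obtain rfl := hfy.eq_of_apply_eq_one (show ‖x‖ = 1 by simpa using hx).le hfx
    exact ⟨hx, f, hf, hfy⟩

end ConditionStar

end BanachGeometry

theorem mainTheorem7 (X : Type*) [NormedAddCommGroup X] [NormedSpace ℝ X] [CompleteSpace X]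
    (hX : BanachGeometry.IsAsplund (StrongDual ℝ X)) :
    BanachGeometry.ConditionStar X ↔
      Metric.sphere (0 : X) 1 ⊆ closure (BanachGeometry.stronglyExposedPoints X) :=
  ⟨BanachGeometry.ConditionStar.dense_stronglyExposedPoints hX,
    BanachGeometry.conditionStar_of_dense_stronglyExposedPoints⟩
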